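/- Let $M$ be a smooth manifold (Hausdorff, second countable) carrying two symplectic forms $\omega_1,\omega_2$. For $j=1,2$ let $L_j\to M$ be a smooth complex line bundle with a smooth complex connection $\nabla_j$ such that $\mathrm{curv}(\nabla_j)=-i\,\omega_j$ (a pre-quantum line bundle for $(M,\omega_j)$). Let $\psi:(M,\omega_1,L_1,\nabla_1)\to(M,\omega_2,L_2,\nabla_2)$ be a symplectomorphism compatible with the line bundles: $\psi:M\to M$ is a diffeomorphism with $\psi^*\omega_2=\omega_1$ and $\psi^*L_2\simeq L_1$ as topological complex line bundles (the bundle isomorphism is not required to intertwine the connections). Suppose that $\psi$ is isotopic to the identity, i.e. there is a smooth map $[0,1]\times M\to M$, $(t,x)\mapsto\psi_t(x)$, with every $\psi_t$ a diffeomorphism of $M$, $\psi_0=\mathrm{id}$ and $\psi_1=\psi$. Then for every embedded submanifold $\Sigma\subset M$ of codimension $2$ the restrictions $L_1|_\Sigma$ and $L_2|_\Sigma$ are isomorphic as topological complex line bundles over $\Sigma$. -/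

import Mathlib

open Bundle
open scoped Manifold ContDiff

noncomputable section

namespace Prequantum

section Base

variable {E : Type*} [NormedAddCommGroup E] [NormedSpace ℝ E]
  {M : Type*} [TopologicalSpace M] [ChartedSpace E M]

/-- A symplectic form on the smooth manifold `M`: a smooth section `Ω` of the bundle of bilinear
forms on the tangent bundle which is alternating, nondegenerate and closed. Closedness is
`d Ω (X, Y, Z) = 0` for all smooth vector fields, with `d Ω` written by the invariant formula. -/
structure IsSymplecticForm [IsManifold 𝓘(ℝ, E) ∞ M]
    (Ω : ∀ x : M, TangentSpace 𝓘(ℝ, E) x →L[ℝ] TangentSpace 𝓘(ℝ, E) x →L[ℝ] ℝ) : Prop where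
  smooth : ContMDiff 𝓘(ℝ, E) (𝓘(ℝ, E).prod 𝓘(ℝ, E →L[ℝ] E →L[ℝ] ℝ)) ∞
    (fun x ↦ TotalSpace.mk' (E →L[ℝ] E →L[ℝ] ℝ)
      (E := fun x : M ↦ TangentSpace 𝓘(ℝ, E) x →L[ℝ] TangentSpace 𝓘(ℝ, E) x →L[ℝ] ℝ) x (Ω x))
  alternating : ∀ (x : M) (v : TangentSpace 𝓘(ℝ, E) x), Ω x v v = 0
  nondegenerate : ∀ (x : M) (v : TangentSpace 𝓘(ℝ, E) x), (∀ w, Ω x v w = 0) → v = 0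
  closed : ∀ X Y Z : ∀ x : M, TangentSpace 𝓘(ℝ, E) x,
    ContMDiff 𝓘(ℝ, E) (𝓘(ℝ, E).prod 𝓘(ℝ, E)) ∞ (fun x ↦ TotalSpace.mk' E x (X x)) →
    ContMDiff 𝓘(ℝ, E) (𝓘(ℝ, E).prod 𝓘(ℝ, E)) ∞ (fun x ↦ TotalSpace.mk' E x (Y x)) →
    ContMDiff 𝓘(ℝ, E) (𝓘(ℝ, E).prod 𝓘(ℝ, E)) ∞ (fun x ↦ TotalSpace.mk' E x (Z x)) →
    ∀ x : M,
      mvfderiv 𝓘(ℝ, E) (fun y ↦ Ω y (Y y) (Z y)) x (X x)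
        + mvfderiv 𝓘(ℝ, E) (fun y ↦ Ω y (Z y) (X y)) x (Y x)
        + mvfderiv 𝓘(ℝ, E) (fun y ↦ Ω y (X y) (Y y)) x (Z x)
        - Ω x (VectorField.mlieBracket 𝓘(ℝ, E) X Y x) (Z x)
        - Ω x (VectorField.mlieBracket 𝓘(ℝ, E) Y Z x) (X x)
        - Ω x (VectorField.mlieBracket 𝓘(ℝ, E) Z X x) (Y x) = 0

/-- The diffeomorphism `ψ` satisfies `ψ^* ω₂ = ω₁`. -/
def IsSymplectomorphism (ψ : M ≃ₘ⟮𝓘(ℝ, E), 𝓘(ℝ, E)⟯ M)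
    (ω₁ ω₂ : ∀ x : M, TangentSpace 𝓘(ℝ, E) x →L[ℝ] TangentSpace 𝓘(ℝ, E) x →L[ℝ] ℝ) : Prop :=
  ∀ (x : M) (v w : TangentSpace 𝓘(ℝ, E) x),
    ω₂ (ψ x) (mfderiv 𝓘(ℝ, E) 𝓘(ℝ, E) ψ x v) (mfderiv 𝓘(ℝ, E) 𝓘(ℝ, E) ψ x w) = ω₁ x v w

/-- `ψ` is isotopic to the identity: there is a smooth family of diffeomorphisms `ψ_t`,
`t ∈ [0, 1]`, with `ψ_0 = id` and `ψ_1 = ψ`. -/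
def IsIsotopicToId (ψ : M ≃ₘ⟮𝓘(ℝ, E), 𝓘(ℝ, E)⟯ M) : Prop :=
  ∃ Ψ : unitInterval → (M ≃ₘ⟮𝓘(ℝ, E), 𝓘(ℝ, E)⟯ M),
    ContMDiff ((𝓡∂ 1).prod 𝓘(ℝ, E)) 𝓘(ℝ, E) ∞ (fun p : unitInterval × M ↦ Ψ p.1 p.2) ∧
    (∀ x, Ψ 0 x = x) ∧ (∀ x, Ψ 1 x = ψ x)

/-- The subset `S` of `M`, with the given smooth atlas, is an embedded submanifold of
codimension two: the inclusion is a smooth embedding and `dim S + 2 = dim M`. -/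
structure IsCodimTwoSubmanifold {E' : Type*} [NormedAddCommGroup E'] [NormedSpace ℝ E']
    (S : Set M) [ChartedSpace E' S] : Prop where
  isManifold : IsManifold 𝓘(ℝ, E') ∞ S
  isSmoothEmbedding :
    Manifold.IsSmoothEmbedding 𝓘(ℝ, E') 𝓘(ℝ, E) ∞ (Subtype.val : S → M)
  finiteDimensional : FiniteDimensional ℝ E'
  codim : Module.finrank ℝ E' + 2 = Module.finrank ℝ E

end Base

section LineBundle

/-- Two topological complex line bundles `L₁`, `L₂` over the same base are isomorphic: there is a
family of `ℂ`-linear isomorphisms of the fibres which, with its inverse, is continuous on the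
total spaces. -/
def TopIsomorphic {B : Type*} (L₁ L₂ : B → Type*)
    [∀ b, AddCommMonoid (L₁ b)] [∀ b, Module ℂ (L₁ b)] [TopologicalSpace (TotalSpace ℂ L₁)]
    [∀ b, AddCommMonoid (L₂ b)] [∀ b, Module ℂ (L₂ b)] [TopologicalSpace (TotalSpace ℂ L₂)] :
    Prop :=
  ∃ φ : ∀ b, L₁ b ≃ₗ[ℂ] L₂ b,
    Continuous (fun p : TotalSpace ℂ L₁ ↦ (⟨p.1, φ p.1 p.2⟩ : TotalSpace ℂ L₂)) ∧
    Continuous (fun p : TotalSpace ℂ L₂ ↦ (⟨p.1, (φ p.1).symm p.2⟩ : TotalSpace ℂ L₁))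

variable {E : Type*} [NormedAddCommGroup E] [NormedSpace ℝ E]
  {M : Type*} [TopologicalSpace M] [ChartedSpace E M] [IsManifold 𝓘(ℝ, E) ∞ M]
  {L : M → Type*} [∀ x, AddCommGroup (L x)] [∀ x, Module ℂ (L x)]
  [∀ x, TopologicalSpace (L x)] [∀ x, IsTopologicalAddGroup (L x)] [∀ x, ContinuousSMul ℝ (L x)]
  [TopologicalSpace (TotalSpace ℂ L)] [FiberBundle ℂ L] [VectorBundle ℝ ℂ L]

/-- `cov` is a smooth complex connection on `L` with curvature `-i Ω`. (In Mathlib's notation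
`cov σ x (X x)` is `(∇_X σ)(x)`; a `CovariantDerivative` over `ℝ` is additive and satisfies the
Leibniz rule for real functions, so that together with `∇ (i σ) = i ∇ σ` it satisfies the Leibniz
rule for complex functions.) -/
structure IsPrequantumConnection
    (Ω : ∀ x : M, TangentSpace 𝓘(ℝ, E) x →L[ℝ] TangentSpace 𝓘(ℝ, E) x →L[ℝ] ℝ)
    (cov : CovariantDerivative 𝓘(ℝ, E) ℂ L) : Prop where
  smooth : ContMDiffCovariantDerivativeOn ℂ ∞ cov.toFun Set.univ
  complexLinear : ∀ (σ : ∀ x, L x) (x : M),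
    MDifferentiableAt 𝓘(ℝ, E) (𝓘(ℝ, E).prod 𝓘(ℝ, ℂ)) (fun y ↦ TotalSpace.mk' ℂ y (σ y)) x →
    ∀ v : TangentSpace 𝓘(ℝ, E) x,
      cov (fun y ↦ Complex.I • σ y) x v = Complex.I • cov σ x v
  curvature : ∀ (X Y : ∀ x : M, TangentSpace 𝓘(ℝ, E) x) (σ : ∀ x, L x),
    ContMDiff 𝓘(ℝ, E) (𝓘(ℝ, E).prod 𝓘(ℝ, E)) ∞ (fun x ↦ TotalSpace.mk' E x (X x)) →
    ContMDiff 𝓘(ℝ, E) (𝓘(ℝ, E).prod 𝓘(ℝ, E)) ∞ (fun x ↦ TotalSpace.mk' E x (Y x)) →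
    ContMDiff 𝓘(ℝ, E) (𝓘(ℝ, E).prod 𝓘(ℝ, ℂ)) ∞ (fun x ↦ TotalSpace.mk' ℂ x (σ x)) →
    ∀ x : M,
      cov (fun y ↦ cov σ y (Y y)) x (X x) - cov (fun y ↦ cov σ y (X y)) x (Y x)
        - cov σ x (VectorField.mlieBracket 𝓘(ℝ, E) X Y x)
        = (-(Complex.I * (Ω x (X x) (Y x) : ℂ))) • σ x

end LineBundle

end Prequantum

end

/-!
The result is an instance of the homotopy invariance of pullbacks of line bundles: `ψ` is homotopic
to the identity, so `L₂ ≅ ψ^* L₂ ≅ L₁` already over `M`, and this isomorphism restricts to `S`.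

Homotopy invariance (`topIsomorphic_pullback_of_homotopic`) is proved for complex line bundles over
paracompact Hausdorff spaces by a discrete form of parallel transport. A partition of unity
provides a continuous kernel `K x y : L x → L y` with `K x x = id`
(`exists_continuous_kernel`); it is invertible near the diagonal
(`eventually_injective_kernel`). Along a homotopy `H`, there is a continuous positive step length
`ε x` such that `K` is invertible between points of the path `t ↦ H (t, x)` at time distance `ε x`
(`exists_step`). Composing `K` along a subdivision of `[0, 1]` into steps of length `ε x` gives
isomorphisms `L (H (0, x)) → L (H (1, x))`. The number of steps jumps with `x`, but steps of length
zero are the identity because `K` is the identity on the diagonal, so superfluous steps do not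
change the composite (`transport.eq_of_le`), and it is continuous in `x`.
-/

namespace Prequantum

open Filter Topology

/-! ### Local frames of line bundles -/

section Frame

variable {B : Type*} [TopologicalSpace B] {L : B → Type*} [∀ x, AddCommMonoid (L x)]
  [∀ x, Module ℂ (L x)] [TopologicalSpace (TotalSpace ℂ L)]

/-- A vector in a fibre over the base set is its coordinate times the frame. -/
theorem smul_symmₗ_one (e : Trivialization ℂ (π ℂ L)) [e.IsLinear ℂ] {b : B}
    (hb : b ∈ e.baseSet) (v : L b) : (e ⟨b, v⟩).2 • e.symmₗ ℂ b 1 = v := by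
  rw [← map_smul, smul_eq_mul, mul_one, ← congrFun (e.coe_linearMapAt_of_mem (R := ℂ) hb) v,
    e.symmₗ_linearMapAt hb]

/-- The local frame of a trivialization is continuous. -/
theorem continuousAt_symmₗ_one (e : Trivialization ℂ (π ℂ L)) [e.IsLinear ℂ] {b : B}
    (hb : b ∈ e.baseSet) :
    ContinuousAt (fun x ↦ (⟨x, e.symmₗ ℂ x 1⟩ : TotalSpace ℂ L)) b := by
  have h : ContinuousAt (fun r : B × ℂ ↦ TotalSpace.mk' ℂ r.1 (e.symm r.1 r.2)) (b, 1) :=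
    e.continuousOn_symm.continuousAt ((e.open_baseSet.prod isOpen_univ).mem_nhds ⟨hb, trivial⟩)
  refine (h.comp' (f := fun x ↦ (x, (1 : ℂ))) (x := b)
    (continuousAt_id.prodMk continuousAt_const)).congr ?_
  filter_upwards [e.open_baseSet.mem_nhds hb] with x hx
  rw [e.symmₗ_apply hx]

end Frame

section Isomorphism

variable {B : Type*} [TopologicalSpace B] {L : B → Type*} [∀ x, AddCommMonoid (L x)]
  [∀ x, Module ℂ (L x)] [TopologicalSpace (TotalSpace ℂ L)] [∀ x, TopologicalSpace (L x)]
  [FiberBundle ℂ L] [VectorBundle ℂ ℂ L]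

theorem finrank_fiber (b : B) : Module.finrank ℂ (L b) = 1 :=
  (((trivializationAt ℂ L b).linearEquivAt ℂ b
    (mem_baseSet_trivializationAt ℂ L b)).finrank_eq).trans (Module.finrank_self ℂ)

/-- A continuous family of fibrewise isomorphisms of line bundles is an isomorphism: in local frames
it is multiplication by a continuous nonvanishing function `g`, and its inverse is division by
`g`. -/
theorem topIsomorphic_of_continuous {L' : B → Type*} [∀ x, AddCommMonoid (L' x)]
    [∀ x, Module ℂ (L' x)] [∀ x, TopologicalSpace (L' x)]
    [TopologicalSpace (TotalSpace ℂ L')] [FiberBundle ℂ L'] [VectorBundle ℂ ℂ L']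
    (φ : ∀ x, L x ≃ₗ[ℂ] L' x)
    (hφ : Continuous fun p : TotalSpace ℂ L ↦ (⟨p.1, φ p.1 p.2⟩ : TotalSpace ℂ L')) :
    Prequantum.TopIsomorphic L L' := by
  refine ⟨φ, hφ, continuous_iff_continuousAt.2 fun q₀ ↦ ?_⟩
  rw [FiberBundle.continuousAt_totalSpace]
  have hproj : Continuous fun q : TotalSpace ℂ L' ↦ q.1 := FiberBundle.continuous_proj ℂ L'
  refine ⟨hproj.continuousAt, ?_⟩
  let b := q₀.1
  let e := trivializationAt ℂ L b
  let e' := trivializationAt ℂ L' b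
  have hb : b ∈ e.baseSet := mem_baseSet_trivializationAt ℂ L b
  have hb' : b ∈ e'.baseSet := mem_baseSet_trivializationAt ℂ L' b
  have hg : ContinuousAt (fun x ↦ (⟨x, φ x (e.symmₗ ℂ x 1)⟩ : TotalSpace ℂ L')) b :=
    hφ.continuousAt.comp' (f := fun x ↦ (⟨x, e.symmₗ ℂ x 1⟩ : TotalSpace ℂ L)) (x := b)
      (continuousAt_symmₗ_one e hb)
  have hg : ContinuousAt (fun x ↦ (e' ⟨x, φ x (e.symmₗ ℂ x 1)⟩).2) b :=
    ((FiberBundle.continuousAt_totalSpace _ _).1 hg).2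
  have hcoord : ∀ x ∈ e.baseSet, x ∈ e'.baseSet → ∀ w : L' x,
      (e' ⟨x, w⟩).2 = (e ⟨x, (φ x).symm w⟩).2 * (e' ⟨x, φ x (e.symmₗ ℂ x 1)⟩).2 := by
    intro x hx hx' w
    have h1 := congrArg (φ x) (smul_symmₗ_one e hx ((φ x).symm w))
    rw [map_smul, LinearEquiv.apply_symm_apply] at h1
    have h2 := congrArg (e'.linearMapAt ℂ x) h1
    rw [map_smul, e'.coe_linearMapAt_of_mem hx', smul_eq_mul] at h2
    exact h2.symm
  have hne : ∀ x ∈ e.baseSet, x ∈ e'.baseSet → (e' ⟨x, φ x (e.symmₗ ℂ x 1)⟩).2 ≠ 0 := by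
    intro x hx hx' h0
    have h1 := hcoord x hx hx' (e'.symmₗ ℂ x 1)
    rw [h0, mul_zero, ← congrFun (e'.coe_linearMapAt_of_mem (R := ℂ) hx'),
      e'.linearMapAt_symmₗ hx'] at h1
    exact one_ne_zero h1
  have hq₀ : ContinuousAt (fun q : TotalSpace ℂ L' ↦ (e' q).2) q₀ :=
    (e'.continuousAt (e'.mem_source.2 hb')).snd
  refine (hq₀.div (hg.comp' (f := fun q : TotalSpace ℂ L' ↦ q.1) (x := q₀) hproj.continuousAt)
    (hne b hb hb')).congr ?_
  filter_upwards [hproj.continuousAt.eventually (e.open_baseSet.mem_nhds hb),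
    hproj.continuousAt.eventually (e'.open_baseSet.mem_nhds hb')] with q h1 h2
  exact (eq_div_of_mul_eq (hne q.1 h1 h2) (hcoord q.1 h1 h2 q.2).symm).symm

end Isomorphism

/-! ### A continuous kernel between the fibres -/

/-- A line bundle `L` over a paracompact Hausdorff base carries a continuous family of linear maps
`K x y : L x → L y` between any two fibres, equal to the identity for `x = y`. With a partition of
unity `ρ i` subordinate to trivializations `e i`, it is the sum of the
`ρ i x * ρ i y • (e i y)⁻¹ ∘ e i x`, divided by `∑ ρ i x ^ 2`. Away from the diagonal `K x y` may
vanish. -/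
theorem exists_continuous_kernel {B : Type*} [TopologicalSpace B] [T2Space B] [ParacompactSpace B]
    (L : B → Type*) [∀ x, AddCommGroup (L x)] [∀ x, Module ℂ (L x)] [∀ x, TopologicalSpace (L x)]
    [TopologicalSpace (TotalSpace ℂ L)] [FiberBundle ℂ L] [VectorBundle ℂ ℂ L] :
    ∃ K : ∀ x y, L x →ₗ[ℂ] L y, (∀ x, K x x = LinearMap.id) ∧
      Continuous fun p : TotalSpace ℂ L × B ↦ (⟨p.2, K p.1.1 p.2 p.1.2⟩ : TotalSpace ℂ L) := by
  let e : ∀ i : B, Trivialization ℂ (π ℂ L) := fun i ↦ trivializationAt ℂ L i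
  obtain ⟨ρ, hρ⟩ := PartitionOfUnity.exists_isSubordinate (s := (Set.univ : Set B)) isClosed_univ
    (fun i ↦ (e i).baseSet) (fun i ↦ (e i).open_baseSet)
    (fun x _ ↦ Set.mem_iUnion.2 ⟨x, mem_baseSet_trivializationAt ℂ L x⟩)
  let c : B → ℝ := fun x ↦ ∑ᶠ i, ρ i x * ρ i x
  have hc : Continuous c := continuous_finsum (fun i ↦ by fun_prop)
    (ρ.locallyFinite.subset fun i x hx h ↦ hx (by simp [h]))
  have hc0 : ∀ x, c x ≠ 0 := by
    intro x
    obtain ⟨i, hi⟩ := ρ.exists_pos (Set.mem_univ x)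
    refine ne_of_gt (finsum_pos (fun j ↦ mul_self_nonneg _) ⟨i, mul_pos hi hi⟩ ?_)
    exact (ρ.locallyFinite.point_finite x).subset fun i hx h ↦ hx (by simp [h])
  -- The zero extensions of `e i` and its inverse outside the base set are harmless: there `ρ i`
  -- vanishes.
  let k : B → ∀ x y, L x →ₗ[ℂ] L y := fun i x y ↦
    ((ρ i x * ρ i y : ℝ) : ℂ) • (((e i).symmₗ ℂ y).comp ((e i).linearMapAt ℂ x))
  have hk : ∀ x y, ∀ I : Finset B, (Function.support (ρ · y) ⊆ I) →
      ∑ᶠ i, k i x y = ∑ i ∈ I, k i x y := by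
    intro x y I hI
    refine finsum_eq_sum_of_support_subset _ fun i hi ↦ hI fun h ↦ hi ?_
    simp only at h
    simp [k, h]
  refine ⟨fun x y ↦ ((c x : ℂ)⁻¹) • ∑ᶠ i, k i x y, fun x ↦ ?_, ?_⟩
  · have h1 : ∀ i, k i x x = ((ρ i x * ρ i x : ℝ) : ℂ) • LinearMap.id := by
      intro i
      by_cases hx : ρ i x = 0
      · simp [k, hx]
      · have hxi : x ∈ (e i).baseSet := hρ i (subset_tsupport _ hx)
        ext v
        simp only [k, LinearMap.smul_apply, LinearMap.comp_apply, LinearMap.id_apply]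
        rw [(e i).symmₗ_linearMapAt hxi]
    obtain ⟨I, hI⟩ := ρ.exists_finset_nhds x
    have hI := hI.self_of_nhds.2
    have h2 : c x = ∑ i ∈ I, ρ i x * ρ i x := finsum_eq_sum_of_support_subset _
      fun i hi ↦ hI fun h ↦ hi (by simp only at h; simp [h])
    beta_reduce
    rw [hk x x I hI, Finset.sum_congr rfl fun i _ ↦ h1 i, ← Finset.sum_smul, ← Complex.ofReal_sum,
      ← h2, smul_smul, inv_mul_cancel₀ (by exact_mod_cast hc0 x), one_smul]
  · refine continuous_iff_continuousAt.2 fun ⟨p₀, y₀⟩ ↦ ?_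
    rw [FiberBundle.continuousAt_totalSpace]
    refine ⟨continuousAt_snd, ?_⟩
    simp only
    obtain ⟨I, hI⟩ := ρ.exists_finset_nhds y₀
    have hp : Continuous fun q : TotalSpace ℂ L × B ↦ q.1.1 :=
      (FiberBundle.continuous_proj ℂ L).comp continuous_fst
    have hy₀ := mem_baseSet_trivializationAt ℂ L y₀
    -- Near `(p₀, y₀)` the coordinate of the kernel is a sum over the fixed finite set `I`.
    have key : (fun q : TotalSpace ℂ L × B ↦ ((c q.1.1 : ℂ)⁻¹) * ∑ i ∈ I,
          ((ρ i q.1.1 * ρ i q.2 : ℝ) : ℂ) * ((e y₀).linearMapAt ℂ q.2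
            ((e i).symmₗ ℂ q.2 ((e i).linearMapAt ℂ q.1.1 q.1.2)))) =ᶠ[𝓝 (p₀, y₀)]
        fun q ↦ ((trivializationAt ℂ L y₀)
          ⟨q.2, (((c q.1.1 : ℂ)⁻¹) • ∑ᶠ i, k i q.1.1 q.2) q.1.2⟩).2 := by
      filter_upwards [continuousAt_snd.eventually hI, continuousAt_snd.eventually
        ((e y₀).open_baseSet.mem_nhds hy₀)] with q hq hq'
      rw [hk _ _ I hq.2]
      have := congrFun ((e y₀).coe_linearMapAt_of_mem (R := ℂ) hq')
        ((((c q.1.1 : ℂ)⁻¹) • ∑ i ∈ I, k i q.1.1 q.2) q.1.2)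
      refine Eq.trans ?_ this
      simp [k, LinearMap.sum_apply, map_sum]
    refine ContinuousAt.congr ?_ key
    refine ContinuousAt.mul ?_ ?_
    · refine ContinuousAt.inv₀ ?_ (by exact_mod_cast hc0 _)
      exact (Complex.continuous_ofReal.comp (hc.comp hp)).continuousAt
    refine tendsto_finsetSum _ fun i _ ↦ ?_
    have hvan : ∀ (z : TotalSpace ℂ L × B → B), ContinuousAt z (p₀, y₀) →
        z (p₀, y₀) ∉ tsupport (ρ i) → ∀ᶠ q in 𝓝 (p₀, y₀), ρ i (z q) = 0 := by
      intro z hz h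
      exact hz.eventually (notMem_tsupport_iff_eventuallyEq.1 h)
    -- A term vanishes near `(p₀, y₀)` unless both points lie in the closed support of `ρ i`, hence in
    -- the base set of `e i`.
    by_cases h1 : p₀.1 ∈ tsupport (ρ i)
    swap
    · refine ContinuousAt.congr (f := fun _ ↦ (0 : ℂ)) continuousAt_const ?_
      filter_upwards [hvan _ hp.continuousAt h1] with q hq
      simp [hq]
    by_cases h2 : y₀ ∈ tsupport (ρ i)
    swap
    · refine ContinuousAt.congr (f := fun _ ↦ (0 : ℂ)) continuousAt_const ?_
      filter_upwards [hvan _ continuousAt_snd h2] with q hq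
      simp [hq]
    have h1 := hρ i h1
    have h2 := hρ i h2
    refine ContinuousAt.mul ?_ ?_
    · exact (Complex.continuous_ofReal.comp (((ρ i).continuous.comp hp).mul
        ((ρ i).continuous.comp continuous_snd))).continuousAt
    have hA : ContinuousAt (fun q : TotalSpace ℂ L × B ↦ ((e i) q.1).2) (p₀, y₀) := by
      have : ContinuousAt (e i) p₀ := (e i).continuousAt ((e i).mem_source.2 h1)
      exact (this.comp' (f := Prod.fst) (x := (p₀, y₀)) continuousAt_fst).snd
    have hB : ContinuousAt (fun q : TotalSpace ℂ L × B ↦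
        ((e y₀) (⟨q.2, (e i).symm q.2 ((e i) q.1).2⟩ : TotalSpace ℂ L)).2) (p₀, y₀) := by
      have h3 : ContinuousAt (fun r : B × ℂ ↦ TotalSpace.mk' ℂ r.1 ((e i).symm r.1 r.2))
          (y₀, ((e i) p₀).2) :=
        (e i).continuousOn_symm.continuousAt
          (((e i).open_baseSet.prod isOpen_univ).mem_nhds ⟨h2, trivial⟩)
      have h4 := (FiberBundle.continuousAt_totalSpace _ _).1 h3 |>.2
      exact ContinuousAt.comp (f := fun q : TotalSpace ℂ L × B ↦ (q.2, ((e i) q.1).2))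
        (x := (p₀, y₀)) h4 (continuousAt_snd.prodMk hA)
    refine hB.congr ?_
    filter_upwards [hp.continuousAt.eventually ((e i).open_baseSet.mem_nhds h1),
      continuousAt_snd.eventually ((e i).open_baseSet.mem_nhds h2),
      continuousAt_snd.eventually ((e y₀).open_baseSet.mem_nhds hy₀)] with q hq1 hq2 hq3
    rw [(e y₀).coe_linearMapAt_of_mem (R := ℂ) hq3, (e i).coe_linearMapAt_of_mem (R := ℂ) hq1,
      (e i).symmₗ_apply hq2]

section Kernel

variable {B : Type*} [TopologicalSpace B] {L : B → Type*} [∀ x, AddCommGroup (L x)]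
  [∀ x, Module ℂ (L x)] [TopologicalSpace (TotalSpace ℂ L)] [∀ x, TopologicalSpace (L x)]
  [FiberBundle ℂ L] [VectorBundle ℂ ℂ L]

/-- A continuous kernel which is the identity on the diagonal is fibrewise injective near it,
because in local frames it is a continuous scalar function with value `1` on the diagonal. -/
theorem eventually_injective_kernel (K : ∀ x y, L x →ₗ[ℂ] L y) (hK : ∀ x, K x x = LinearMap.id)
    (hcont : Continuous fun p : TotalSpace ℂ L × B ↦ (⟨p.2, K p.1.1 p.2 p.1.2⟩ : TotalSpace ℂ L))
    (x₀ : B) : ∀ᶠ q : B × B in 𝓝 (x₀, x₀), Function.Injective (K q.1 q.2) := by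
  let e := trivializationAt ℂ L x₀
  have hx₀ : x₀ ∈ e.baseSet := mem_baseSet_trivializationAt ℂ L x₀
  have hg : ContinuousAt
      (fun q : B × B ↦ (⟨q.2, K q.1 q.2 (e.symmₗ ℂ q.1 1)⟩ : TotalSpace ℂ L)) (x₀, x₀) :=
    hcont.continuousAt.comp' (f := fun q : B × B ↦
        ((⟨q.1, e.symmₗ ℂ q.1 1⟩ : TotalSpace ℂ L), q.2)) (x := (x₀, x₀))
      (((continuousAt_symmₗ_one e hx₀).comp' (f := Prod.fst) (x := (x₀, x₀))
        continuousAt_fst).prodMk continuousAt_snd)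
  have hg := ((FiberBundle.continuousAt_totalSpace _ _).1 hg).2
  have hne : (e ⟨x₀, K x₀ x₀ (e.symmₗ ℂ x₀ 1)⟩).2 ≠ 0 := by
    rw [hK, LinearMap.id_apply, ← congrFun (e.coe_linearMapAt_of_mem (R := ℂ) hx₀),
      e.linearMapAt_symmₗ hx₀]
    exact one_ne_zero
  filter_upwards [hg.eventually_ne hne,
    continuousAt_fst.eventually (e.open_baseSet.mem_nhds hx₀),
    continuousAt_snd.eventually (e.open_baseSet.mem_nhds hx₀)] with q hq h1 h2
  refine (injective_iff_map_eq_zero _).2 fun v hv ↦ ?_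
  rw [← smul_symmₗ_one e h1 v, map_smul] at hv
  rcases smul_eq_zero.1 hv with h | h
  · rw [← smul_symmₗ_one e h1 v, h, zero_smul]
  · refine absurd ?_ hq
    simp only [h]
    exact (congrFun (e.coe_linearMapAt_of_mem (R := ℂ) h2) 0).symm.trans (map_zero _)

end Kernel

/-! ### Discrete transport along a homotopy -/

/-- If a relation `P` holds near the diagonal of `B`, then the points of the path `t ↦ H (t, x)` at
distance `ε x` in time are related by `P`, for some continuous positive `ε`. The admissible step
lengths at a point form an interval, so locally constant choices are glued by a partition of
unity. -/
theorem exists_step {B X : Type*} [TopologicalSpace B] [TopologicalSpace X]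
    [T2Space X] [ParacompactSpace X] (P : B → B → Prop)
    (hP : ∀ b, ∀ᶠ q : B × B in 𝓝 (b, b), P q.1 q.2) (H : C(ℝ × X, B)) :
    ∃ ε : C(X, ℝ), ∀ x, 0 < ε x ∧ ∀ t ∈ Set.Icc (0 : ℝ) 1,
      P (H (max (t - ε x) 0, x)) (H (t, x)) := by
  suffices h : ∃ ε : C(X, ℝ), ∀ x, ε x ∈ {ε : ℝ | 0 < ε ∧ ∀ δ ∈ Set.Icc 0 ε,
      ∀ t ∈ Set.Icc (0 : ℝ) 1, P (H (max (t - δ) 0, x)) (H (t, x))} by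
    obtain ⟨ε, hε⟩ := h
    exact ⟨ε, fun x ↦ ⟨(hε x).1, (hε x).2 _ ⟨(hε x).1.le, le_rfl⟩⟩⟩
  refine exists_continuous_forall_mem_convex_of_local_const ?_ ?_
  · refine fun x ↦ Set.OrdConnected.convex ⟨fun a ha b hb c hc ↦ ⟨ha.1.trans_le hc.1, ?_⟩⟩
    exact fun δ hδ ↦ hb.2 δ ⟨hδ.1, hδ.2.trans hc.2⟩
  · intro x
    -- At `δ = 0` the two points coincide, so compactness of `[0, 1]` yields a uniform step near `x`.
    have h : ∀ᶠ z : X × ℝ in 𝓝 (x, 0), ∀ t ∈ Set.Icc (0 : ℝ) 1,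
        P (H (max (t - z.2) 0, z.1)) (H (t, z.1)) := by
      refine isCompact_Icc.eventually_forall_of_forall_eventually fun t ht ↦ ?_
      have hc : Continuous fun w : (X × ℝ) × ℝ ↦
          (H (max (w.2 - w.1.2) 0, w.1.1), H (w.2, w.1.1)) := by fun_prop
      refine (hc.tendsto' ((x, 0), t) (H (t, x), H (t, x)) ?_).eventually (hP _)
      simp [ht.1]
    rw [nhds_prod_eq] at h
    obtain ⟨p, hp, q, hq, hpq⟩ := eventually_prod_iff.1 h
    obtain ⟨r, hr, hrq⟩ := Metric.eventually_nhds_iff.1 hq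
    refine ⟨r / 2, hp.mono fun y hy ↦ ⟨half_pos hr, fun δ hδ ↦ hpq hy (hrq ?_)⟩⟩
    rw [Real.dist_eq, sub_zero, abs_of_nonneg hδ.1]
    linarith [hδ.2]

section Transport

variable {B : Type*} {L : B → Type*} [∀ x, AddCommGroup (L x)] [∀ x, Module ℂ (L x)]

/-- Transport in the fibres of `L` along the path `t ↦ H (t, x)`, by the kernel `K` in steps of
length `ε x`. The `n`-th map splits off at most `n` steps, backwards from time `t` and stopping
at time `0`, and covers the remaining time by a single application of `K`. -/
noncomputable def transport {X : Type*} (K : ∀ x y, L x →ₗ[ℂ] L y) (H : ℝ × X → B) (ε : X → ℝ) :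
    ℕ → ∀ (x : X) (t : ℝ), L (H (0, x)) →ₗ[ℂ] L (H (t, x))
  | 0, x, t => K (H (0, x)) (H (t, x))
  | n + 1, x, t => (K (H (max (t - ε x) 0, x)) (H (t, x))).comp
      (transport K H ε n x (max (t - ε x) 0))

namespace transport

variable {X : Type*} {K : ∀ x y, L x →ₗ[ℂ] L y} {ε : X → ℝ} {H : ℝ × X → B} {x : X}

theorem apply_zero (hK : ∀ x, K x x = LinearMap.id) (hε : 0 < ε x) (n : ℕ) :
    transport K H ε n x 0 = LinearMap.id := by
  induction n with
  | zero => exact hK _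
  | succ n ih =>
    have h : max (0 - ε x) 0 = 0 := max_eq_right (by linarith)
    rw [transport, h, ih, hK]
    rfl

/-- Once `n + 1` steps reach back to time `0`, a further step has no effect: it applies `K` at a
diagonal point. -/
theorem succ_eq (hK : ∀ x, K x x = LinearMap.id) (hε : 0 < ε x) (n : ℕ) :
    ∀ t : ℝ, t ≤ (n + 1) * ε x → transport K H ε (n + 1) x t = transport K H ε n x t := by
  induction n with
  | zero =>
    intro t ht
    have h : max (t - ε x) 0 = 0 := max_eq_right (by simpa using ht)
    change (K (H (max (t - ε x) 0, x)) (H (t, x))).comp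
      (transport K H ε 0 x (max (t - ε x) 0)) = _
    rw [h, apply_zero hK hε, LinearMap.comp_id]
    rfl
  | succ n ih =>
    intro t ht
    have h : max (t - ε x) 0 ≤ (n + 1) * ε x :=
      max_le (by push_cast at ht; linarith) (by positivity)
    rw [transport, ih _ h, ← transport]

theorem eq_of_le (hK : ∀ x, K x x = LinearMap.id) (hε : 0 < ε x) {m n : ℕ}
    (hmn : n ≤ m) {t : ℝ} (ht : t ≤ (n + 1) * ε x) :
    transport K H ε m x t = transport K H ε n x t := by
  induction m, hmn using Nat.le_induction with
  | base => rfl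
  | succ m hm ih =>
    rw [succ_eq hK hε m t, ih]
    refine ht.trans ?_
    gcongr

/-- Injectivity needs enough steps to reach back to time `0`, since only points at time distance
`ε x` are known to be joined by an injective `K`. -/
theorem injective (hε : 0 < ε x) (hinj : ∀ t ∈ Set.Icc (0 : ℝ) 1,
      Function.Injective (K (H (max (t - ε x) 0, x)) (H (t, x)))) (n : ℕ) :
    ∀ t ∈ Set.Icc (0 : ℝ) 1, t ≤ (n + 1) * ε x →
      Function.Injective (transport K H ε n x t) := by
  induction n with
  | zero =>
    intro t ht htn
    have h : max (t - ε x) 0 = 0 := max_eq_right (by simpa using htn)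
    have := hinj t ht
    rwa [h] at this
  | succ n ih =>
    intro t ht htn
    have h : max (t - ε x) 0 ≤ (n + 1) * ε x :=
      max_le (by push_cast at htn; linarith) (by positivity)
    exact (hinj t ht).comp (ih _ ⟨le_max_right _ _, max_le (by linarith [ht.2]) zero_le_one⟩ h)

end transport

end Transport

section TransportContinuous

variable {B : Type*} [TopologicalSpace B] {L : B → Type*} [∀ x, AddCommGroup (L x)]
  [∀ x, Module ℂ (L x)] [TopologicalSpace (TotalSpace ℂ L)]

theorem transport.continuous {X : Type*} [TopologicalSpace X]
    {K : ∀ x y, L x →ₗ[ℂ] L y} {ε : X → ℝ} (H : C(ℝ × X, B)) (hε : Continuous ε)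
    (hcont : Continuous fun p : TotalSpace ℂ L × B ↦ (⟨p.2, K p.1.1 p.2 p.1.2⟩ : TotalSpace ℂ L))
    (n : ℕ) : Continuous fun q : TotalSpace ℂ ((fun x ↦ H (0, x)) *ᵖ L) × ℝ ↦
      (⟨H (q.2, q.1.1), transport K H ε n q.1.1 q.2 q.1.2⟩ : TotalSpace ℂ L) := by
  have hproj : Continuous fun q : TotalSpace ℂ ((fun x ↦ H (0, x)) *ᵖ L) × ℝ ↦ q.1.1 :=
    (Pullback.continuous_proj ℂ L _).comp continuous_fst
  have hH : Continuous fun q : TotalSpace ℂ ((fun x ↦ H (0, x)) *ᵖ L) × ℝ ↦ H (q.2, q.1.1) :=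
    H.continuous.comp (continuous_snd.prodMk hproj)
  induction n with
  | zero =>
    exact hcont.comp (((Pullback.continuous_lift ℂ L _).comp continuous_fst).prodMk hH)
  | succ n ih =>
    have hs : Continuous fun q : TotalSpace ℂ ((fun x ↦ H (0, x)) *ᵖ L) × ℝ ↦
        (q.1, max (q.2 - ε q.1.1) 0) :=
      continuous_fst.prodMk ((continuous_snd.sub (hε.comp hproj)).max continuous_const)
    exact hcont.comp ((ih.comp hs).prodMk hH)

end TransportContinuous

/-! ### Homotopy invariance -/

section Homotopy

variable {B : Type*} [TopologicalSpace B] {L : B → Type*} [∀ x, AddCommGroup (L x)]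
  [∀ x, Module ℂ (L x)] [TopologicalSpace (TotalSpace ℂ L)] [∀ x, TopologicalSpace (L x)]
  [FiberBundle ℂ L] [VectorBundle ℂ ℂ L]

/-- The isomorphism at `x` is the transport up to time `1` with sufficiently many steps. Their
number is not locally constant, but the transport does not depend on it. -/
theorem topIsomorphic_pullback_of_real_homotopy {X : Type*} [TopologicalSpace X]
    [T2Space B] [ParacompactSpace B] [T2Space X] [ParacompactSpace X] (H : C(ℝ × X, B)) :
    Prequantum.TopIsomorphic ((H.curry 0) *ᵖ L) ((H.curry 1) *ᵖ L) := by
  obtain ⟨K, hK, hcont⟩ := exists_continuous_kernel L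
  obtain ⟨ε, hε⟩ := exists_step (fun b b' ↦ Function.Injective (K b b'))
    (eventually_injective_kernel K hK hcont) H
  -- The strict inequality persists near `x` for a fixed number of steps.
  have hN : ∀ x, 1 < (⌈1 / ε x⌉₊ + 1) * ε x := by
    intro x
    have h := Nat.le_ceil (1 / ε x)
    rw [div_le_iff₀ (hε x).1] at h
    linarith [(hε x).1]
  let φ₀ : ∀ x, L (H (0, x)) →ₗ[ℂ] L (H (1, x)) := fun x ↦ transport K H ε ⌈1 / ε x⌉₊ x 1
  have hφ₀ : ∀ x, Function.Injective (φ₀ x) := fun x ↦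
    transport.injective (hε x).1 (hε x).2 _ 1 ⟨zero_le_one, le_rfl⟩ (hN x).le
  have hfin : ∀ b, FiniteDimensional ℂ (L b) := fun b ↦
    Module.finite_of_finrank_pos (by rw [finrank_fiber b]; exact one_pos)
  let φ : ∀ x, L (H (0, x)) ≃ₗ[ℂ] L (H (1, x)) := fun x ↦
    (φ₀ x).linearEquivOfInjective (hφ₀ x) (by simp only [finrank_fiber])
  refine topIsomorphic_of_continuous φ ?_
  refine (inducing_pullbackTotalSpaceEmbedding ℂ L _).continuous_iff.2 ?_
  have hproj : Continuous fun q : TotalSpace ℂ ((fun x ↦ H (0, x)) *ᵖ L) ↦ q.1 :=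
    Pullback.continuous_proj ℂ L _
  refine hproj.prodMk (continuous_iff_continuousAt.2 fun q₀ ↦ ?_)
  have hc := (transport.continuous H ε.continuous hcont ⌈1 / ε q₀.1⌉₊).comp
    (continuous_id.prodMk (continuous_const (y := (1 : ℝ))))
  refine hc.continuousAt.congr ?_
  have hev : ∀ᶠ x in 𝓝 q₀.1, 1 < (⌈1 / ε q₀.1⌉₊ + 1) * ε x :=
    (continuous_const.mul ε.continuous).continuousAt.eventually_const_lt (hN q₀.1)
  filter_upwards [hproj.continuousAt.eventually hev] with q hq
  have : transport K H ε ⌈1 / ε q₀.1⌉₊ q.1 1 = transport K H ε ⌈1 / ε q.1⌉₊ q.1 1 := by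
    rcases le_total ⌈1 / ε q₀.1⌉₊ ⌈1 / ε q.1⌉₊ with h | h
    · exact (transport.eq_of_le hK (hε _).1 h hq.le).symm
    · exact transport.eq_of_le hK (hε _).1 h (hN _).le
  exact congrArg (fun f : L (H (0, q.1)) →ₗ[ℂ] L (H (1, q.1)) ↦
    (⟨H (1, q.1), f q.2⟩ : TotalSpace ℂ L)) this

/-- Homotopy invariance of pullbacks of complex line bundles. -/
theorem topIsomorphic_pullback_of_homotopic {X : Type*} [TopologicalSpace X]
    [T2Space B] [ParacompactSpace B] [T2Space X] [ParacompactSpace X]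
    {f g : C(X, B)} (h : f.Homotopic g) :
    Prequantum.TopIsomorphic (f *ᵖ L) (g *ᵖ L) := by
  obtain ⟨F⟩ := h
  let H : C(ℝ × X, B) := ⟨fun q ↦ F (Set.projIcc 0 1 zero_le_one q.1, q.2), by fun_prop⟩
  have h0 : H.curry 0 = f := by ext x; simp [H]
  have h1 : H.curry 1 = g := by ext x; simp [H]
  have := topIsomorphic_pullback_of_real_homotopy (L := L) H
  rwa [h0, h1] at this

end Homotopy

/-! ### Operations on isomorphisms of line bundles -/

namespace TopIsomorphic

variable {B : Type*} {L₁ L₂ L₃ : B → Type*}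
  [∀ b, AddCommMonoid (L₁ b)] [∀ b, Module ℂ (L₁ b)] [TopologicalSpace (TotalSpace ℂ L₁)]
  [∀ b, AddCommMonoid (L₂ b)] [∀ b, Module ℂ (L₂ b)] [TopologicalSpace (TotalSpace ℂ L₂)]
  [∀ b, AddCommMonoid (L₃ b)] [∀ b, Module ℂ (L₃ b)] [TopologicalSpace (TotalSpace ℂ L₃)]

theorem symm (h : TopIsomorphic L₁ L₂) : TopIsomorphic L₂ L₁ := by
  obtain ⟨φ, h1, h2⟩ := h
  exact ⟨fun b ↦ (φ b).symm, h2, h1⟩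

theorem trans (h : TopIsomorphic L₁ L₂) (h' : TopIsomorphic L₂ L₃) : TopIsomorphic L₁ L₃ := by
  obtain ⟨φ, h1, h2⟩ := h
  obtain ⟨φ', h1', h2'⟩ := h'
  exact ⟨fun b ↦ (φ b).trans (φ' b), h1'.comp h1, h2.comp h2'⟩

theorem id_pullback [TopologicalSpace B] (hproj : Continuous (π ℂ L₁)) :
    TopIsomorphic ((id : B → B) *ᵖ L₁) L₁ := by
  refine ⟨fun b ↦ LinearEquiv.refl ℂ (L₁ b), Pullback.continuous_lift ℂ L₁ id, ?_⟩
  exact (inducing_pullbackTotalSpaceEmbedding ℂ L₁ id).continuous_iff.2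
    (hproj.prodMk continuous_id)

theorem pullback (h : TopIsomorphic L₁ L₂) {X : Type*} [TopologicalSpace X] (f : X → B) :
    TopIsomorphic (f *ᵖ L₁) (f *ᵖ L₂) := by
  obtain ⟨φ, h1, h2⟩ := h
  refine ⟨fun x ↦ φ (f x), ?_, ?_⟩
  · exact (inducing_pullbackTotalSpaceEmbedding ℂ L₂ f).continuous_iff.2
      ((Pullback.continuous_proj ℂ L₁ f).prodMk (h1.comp (Pullback.continuous_lift ℂ L₁ f)))
  · exact (inducing_pullbackTotalSpaceEmbedding ℂ L₁ f).continuous_iff.2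
      ((Pullback.continuous_proj ℂ L₂ f).prodMk (h2.comp (Pullback.continuous_lift ℂ L₂ f)))

end TopIsomorphic

end Prequantum

theorem mainTheorem5
    -- the smooth manifold `M`
    {E : Type*} [NormedAddCommGroup E] [NormedSpace ℝ E] [FiniteDimensional ℝ E]
    {M : Type*} [TopologicalSpace M] [T2Space M] [SecondCountableTopology M]
    [ChartedSpace E M] [IsManifold 𝓘(ℝ, E) ∞ M]
    -- the symplectic forms `ω₁` and `ω₂`
    (ω₁ ω₂ : ∀ x : M, TangentSpace 𝓘(ℝ, E) x →L[ℝ] TangentSpace 𝓘(ℝ, E) x →L[ℝ] ℝ)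
    (hω₁ : Prequantum.IsSymplecticForm ω₁) (hω₂ : Prequantum.IsSymplecticForm ω₂)
    -- the smooth complex line bundle `L₁` with its connection `cov₁` of curvature `-i ω₁`
    {L₁ : M → Type*} [∀ x, AddCommGroup (L₁ x)] [∀ x, Module ℂ (L₁ x)]
    [∀ x, TopologicalSpace (L₁ x)] [∀ x, IsTopologicalAddGroup (L₁ x)]
    [∀ x, ContinuousSMul ℝ (L₁ x)]
    [TopologicalSpace (TotalSpace ℂ L₁)] [FiberBundle ℂ L₁] [VectorBundle ℂ ℂ L₁]
    [VectorBundle ℝ ℂ L₁] [ContMDiffVectorBundle ∞ ℂ L₁ 𝓘(ℝ, E)]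
    (cov₁ : CovariantDerivative 𝓘(ℝ, E) ℂ L₁)
    (hcov₁ : Prequantum.IsPrequantumConnection ω₁ cov₁)
    -- the smooth complex line bundle `L₂` with its connection `cov₂` of curvature `-i ω₂`
    {L₂ : M → Type*} [∀ x, AddCommGroup (L₂ x)] [∀ x, Module ℂ (L₂ x)]
    [∀ x, TopologicalSpace (L₂ x)] [∀ x, IsTopologicalAddGroup (L₂ x)]
    [∀ x, ContinuousSMul ℝ (L₂ x)]
    [TopologicalSpace (TotalSpace ℂ L₂)] [FiberBundle ℂ L₂] [VectorBundle ℂ ℂ L₂]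
    [VectorBundle ℝ ℂ L₂] [ContMDiffVectorBundle ∞ ℂ L₂ 𝓘(ℝ, E)]
    (cov₂ : CovariantDerivative 𝓘(ℝ, E) ℂ L₂)
    (hcov₂ : Prequantum.IsPrequantumConnection ω₂ cov₂)
    -- the symplectomorphism `ψ`, which carries `L₁` to `L₂` and is isotopic to the identity
    (ψ : M ≃ₘ⟮𝓘(ℝ, E), 𝓘(ℝ, E)⟯ M)
    (hψ : Prequantum.IsSymplectomorphism ψ ω₁ ω₂)
    (hψL : Prequantum.TopIsomorphic L₁ (ψ *ᵖ L₂))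
    (hiso : Prequantum.IsIsotopicToId ψ)
    -- the submanifold `S`
    {E' : Type*} [NormedAddCommGroup E'] [NormedSpace ℝ E']
    (S : Set M) [ChartedSpace E' S]
    (hS : Prequantum.IsCodimTwoSubmanifold (E := E) (E' := E') S) :
    Prequantum.TopIsomorphic ((Subtype.val : S → M) *ᵖ L₁) ((Subtype.val : S → M) *ᵖ L₂) := by
  have : LocallyCompactSpace M := Manifold.locallyCompact_of_finiteDimensional 𝓘(ℝ, E)
  have hhom : ContinuousMap.Homotopic (ContinuousMap.id M) ⟨ψ, ψ.continuous⟩ := by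
    obtain ⟨Ψ, hΨ, h0, h1⟩ := hiso
    exact ⟨⟨⟨fun p ↦ Ψ p.1 p.2, hΨ.continuous⟩, h0, h1⟩⟩
  have hid : Prequantum.TopIsomorphic ((id : M → M) *ᵖ L₂) (ψ *ᵖ L₂) :=
    Prequantum.topIsomorphic_pullback_of_homotopic (L := L₂) hhom
  have h₂ : Prequantum.TopIsomorphic L₂ (ψ *ᵖ L₂) :=
    (Prequantum.TopIsomorphic.id_pullback (FiberBundle.continuous_proj ℂ L₂)).symm.trans hid
  exact (hψL.trans h₂.symm).pullback _
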